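/- Let $M$ be a compact complex manifold with holomorphic tangent bundle $T^{1,0}$, and let $\Lambda$ be a holomorphic Poisson structure on $M$, i.e. a smooth section of $\wedge^2T^{1,0}$ with $\bar\partial\Lambda=0$ and $[\Lambda,\Lambda]=0$ (Schouten bracket). Put $L=T^{1,0}\oplus T^{*(0,1)}$ and consider $$C^\infty(M,\mathbb C)\xrightarrow{\ \bar\partial_\Lambda\ }C^\infty(L)\xrightarrow{\ \bar\partial_\Lambda\ }C^\infty(\wedge^2L),\qquad \bar\partial_\Lambda=\bar\partial+[\Lambda,-],$$ where $[\Lambda,-]$ is the Schouten bracket extended to sections of $\wedge^\bullet L$ (with $[X,\bar\eta]=\mathcal L_X\bar\eta=\iota_X\partial\bar\eta$ for a $(1,0)$-vector field $X$ and a $(0,1)$-form $\bar\eta$, regarded as sections of $L$). Let $H^1_{\bar\partial_\Lambda}$ be the kernel of the second map modulo the image of the first. Suppose that the Dolbeault cohomology $H^1(M,\mathcal O)$ (smooth $\bar\partial$-closed $(0,1)$-forms modulo the forms $\bar\partial f$, $f\in C^\infty(M,\mathbb C)$) vanishes. Then $$H^1_{\bar\partial_\Lambda}=\{W\in H^0(M,T^{1,0})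 : [\Lambda,W]=0\}.$$ More precisely, every holomorphic vector field $W$ with $[\Lambda,W]=0$ is $\bar\partial_\Lambda$-closed as a section of $L$, and $W\mapsto$ (class of $W$) is an isomorphism of complex vector spaces from the right hand side onto $H^1_{\bar\partial_\Lambda}$. -/

import Mathlib

open scoped Manifold ContDiff

noncomputable section

namespace HolPoisson

/-! ### Wirtinger calculus on `ℂⁿ` -/

/-- The model space `ℂⁿ`. -/
abbrev Cn (n : ℕ) : Type := EuclideanSpace ℂ (Fin n)

/-- The `i`-th coordinate on `ℂⁿ`. -/
def coord {n : ℕ} (i : Fin n) : Cn n →ₗ[ℂ] ℂ :=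
  (EuclideanSpace.proj i : Cn n →L[ℂ] ℂ).toLinearMap

theorem eq_sum_single {n : ℕ} (u : Cn n) :
    u = ∑ k, coord k u • (EuclideanSpace.single k 1 : Cn n) := by
  ext i
  simp [coord, EuclideanSpace.single, Pi.single_apply]

theorem dual_eq_sum {n : ℕ} (α : Cn n →ₗ[ℂ] ℂ) :
    α = ∑ k, α (EuclideanSpace.single k 1) • coord k := by
  refine LinearMap.ext fun u => ?_
  conv_lhs => rw [eq_sum_single u]
  simp only [map_sum, map_smul, LinearMap.sum_apply, LinearMap.smul_apply, smul_eq_mul]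
  exact Finset.sum_congr rfl fun k _ => mul_comm _ _

theorem real_smul_formula {n : ℕ} (T : Cn n →L[ℝ] ℂ) (c : ℂ) (u : Cn n) :
    T (c • u) = c.re * T u + c.im * T (Complex.I • u) := by
  have : c • u = c.re • u + c.im • (Complex.I • u) := by
    ext k
    have hc := Complex.re_add_im c
    simp only [PiLp.smul_apply, PiLp.add_apply, smul_eq_mul, Complex.real_smul]
    linear_combination (-(u k)) * hc
  rw [this]
  simp

/-- The complex linear part `v ↦ (T v - i T (i v)) / 2` of a real linear functional `T` on `ℂⁿ`. -/
def linPart {n : ℕ} (T : Cn n →L[ℝ] ℂ) : Cn n →ₗ[ℂ] ℂ where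
  toFun := fun v => (T v - Complex.I * T (Complex.I • v)) / 2
  map_add' := fun v w => by simp only [smul_add, map_add]; ring
  map_smul' := fun c v => by
    have hc := Complex.re_add_im c
    have h2 : Complex.I • c • v = (Complex.I * c) • v := smul_smul _ _ _
    rw [h2, real_smul_formula T c, real_smul_formula T (Complex.I * c), RingHom.id_apply,
      smul_eq_mul]
    simp only [Complex.mul_re, Complex.mul_im, Complex.I_re, Complex.I_im]
    push_cast
    linear_combination ((T v - Complex.I * T (Complex.I • v)) / 2) * hc
      + ((c.im : ℂ) * T (Complex.I • v) / 2) * Complex.I_sq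

/-- The conjugate linear part `v ↦ (T v + i T (i v)) / 2` of a real linear functional `T`
on `ℂⁿ`. -/
def conjPart {n : ℕ} (T : Cn n →L[ℝ] ℂ) : Cn n →ₛₗ[starRingEnd ℂ] ℂ where
  toFun := fun v => (T v + Complex.I * T (Complex.I • v)) / 2
  map_add' := fun v w => by simp only [smul_add, map_add]; ring
  map_smul' := fun c v => by
    have hc : (c.re : ℂ) - c.im * Complex.I = starRingEnd ℂ c := by
      apply Complex.ext <;> simp
    have h2 : Complex.I • c • v = (Complex.I * c) • v := smul_smul _ _ _
    rw [h2, real_smul_formula T c, real_smul_formula T (Complex.I * c), smul_eq_mul]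
    simp only [Complex.mul_re, Complex.mul_im, Complex.I_re, Complex.I_im]
    push_cast
    linear_combination ((T v + Complex.I * T (Complex.I • v)) / 2) * hc
      + ((c.im : ℂ) * T (Complex.I • v) / 2) * Complex.I_sq

theorem linPart_add {n : ℕ} (S T : Cn n →L[ℝ] ℂ) : linPart (S + T) = linPart S + linPart T := by
  refine LinearMap.ext fun v => ?_
  simp only [linPart, LinearMap.add_apply, LinearMap.coe_mk, AddHom.coe_mk, add_apply]
  ring

theorem linPart_smul {n : ℕ} (c : ℂ) (T : Cn n →L[ℝ] ℂ) : linPart (c • T) = c • linPart T := by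
  refine LinearMap.ext fun v => ?_
  simp only [linPart, LinearMap.smul_apply, LinearMap.coe_mk, AddHom.coe_mk, smul_apply,
    smul_eq_mul]
  ring

theorem conjPart_add {n : ℕ} (S T : Cn n →L[ℝ] ℂ) :
    conjPart (S + T) = conjPart S + conjPart T := by
  refine LinearMap.ext fun v => ?_
  simp only [conjPart, LinearMap.add_apply, LinearMap.coe_mk, AddHom.coe_mk, add_apply]
  ring

theorem conjPart_smul {n : ℕ} (c : ℂ) (T : Cn n →L[ℝ] ℂ) : conjPart (c • T) = c • conjPart T := by
  refine LinearMap.ext fun v => ?_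
  simp only [conjPart, LinearMap.smul_apply, LinearMap.coe_mk, AddHom.coe_mk, smul_apply,
    smul_eq_mul]
  ring

theorem linPart_comp {n : ℕ} (S T : Cn n →L[ℝ] ℂ) (A : Cn n →L[ℂ] Cn n)
    (h : ∀ v, S (A v) = T v) (v : Cn n) : linPart S (A v) = linPart T v := by
  simp only [linPart, LinearMap.coe_mk, AddHom.coe_mk, ← h, map_smul]

theorem conjPart_comp {n : ℕ} (S T : Cn n →L[ℝ] ℂ) (A : Cn n →L[ℂ] Cn n)
    (h : ∀ v, S (A v) = T v) (v : Cn n) : conjPart S (A v) = conjPart T v := by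
  simp only [conjPart, LinearMap.coe_mk, AddHom.coe_mk, ← h, map_smul]

theorem alt_left {V : Type*} [AddCommGroup V] [Module ℂ V] (B : V [⋀^Fin 2]→ₗ[ℂ] ℂ) {n : ℕ}
    (c : Fin n → ℂ) (γ : Fin n → V) (β : V) :
    B ![∑ i, c i • γ i, β] = ∑ i, c i * B ![γ i, β] := by
  have hB : ∀ α : V, B ![α, β] = B.toMultilinearMap.toLinearMap ![0, β] 0 α := by
    intro α
    simp only [MultilinearMap.toLinearMap_apply, AlternatingMap.coe_multilinearMap]
    congr 1
    ext k : 1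
    fin_cases k <;> simp
  rw [hB, map_sum]
  exact Finset.sum_congr rfl fun i _ => by rw [map_smul, ← hB, smul_eq_mul]

theorem alt_right {V : Type*} [AddCommGroup V] [Module ℂ V] (B : V [⋀^Fin 2]→ₗ[ℂ] ℂ) {n : ℕ}
    (c : Fin n → ℂ) (γ : Fin n → V) (β : V) :
    B ![β, ∑ i, c i • γ i] = ∑ i, c i * B ![β, γ i] := by
  have hB : ∀ α : V, B ![β, α] = B.toMultilinearMap.toLinearMap ![β, 0] 1 α := by
    intro α
    simp only [MultilinearMap.toLinearMap_apply, AlternatingMap.coe_multilinearMap]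
    congr 1
    ext k : 1
    fin_cases k <;> simp
  rw [hB, map_sum]
  exact Finset.sum_congr rfl fun i _ => by rw [map_smul, ← hB, smul_eq_mul]

/-- The Wirtinger derivative `∂g/∂z_j = (∂g/∂x_j - i ∂g/∂y_j) / 2` at the point `y`. -/
def wirt {n : ℕ} (g : Cn n → ℂ) (y : Cn n) (j : Fin n) : ℂ :=
  linPart (fderiv ℝ g y) (EuclideanSpace.single j 1)

/-- The Wirtinger derivative `∂g/∂z̄_j = (∂g/∂x_j + i ∂g/∂y_j) / 2` at the point `y`. -/
def wirtBar {n : ℕ} (g : Cn n → ℂ) (y : Cn n) (j : Fin n) : ℂ :=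
  conjPart (fderiv ℝ g y) (EuclideanSpace.single j 1)

theorem wirt_add {n : ℕ} {g h : Cn n → ℂ} {y : Cn n} (hg : DifferentiableAt ℝ g y)
    (hh : DifferentiableAt ℝ h y) (j : Fin n) :
    wirt (fun z => g z + h z) y j = wirt g y j + wirt h y j := by
  simp only [wirt, linPart, LinearMap.coe_mk, AddHom.coe_mk, fderiv_fun_add hg hh,
    add_apply]
  ring

theorem wirt_const_mul {n : ℕ} {g : Cn n → ℂ} {y : Cn n} (hg : DifferentiableAt ℝ g y)
    (c : ℂ) (j : Fin n) : wirt (fun z => c * g z) y j = c * wirt g y j := by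
  simp only [wirt, linPart, LinearMap.coe_mk, AddHom.coe_mk, fderiv_const_mul hg,
    smul_apply, smul_eq_mul]
  ring

theorem wirtBar_add {n : ℕ} {g h : Cn n → ℂ} {y : Cn n} (hg : DifferentiableAt ℝ g y)
    (hh : DifferentiableAt ℝ h y) (j : Fin n) :
    wirtBar (fun z => g z + h z) y j = wirtBar g y j + wirtBar h y j := by
  simp only [wirtBar, conjPart, LinearMap.coe_mk, AddHom.coe_mk, fderiv_fun_add hg hh,
    add_apply]
  ring

theorem wirtBar_const_mul {n : ℕ} {g : Cn n → ℂ} {y : Cn n} (hg : DifferentiableAt ℝ g y)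
    (c : ℂ) (j : Fin n) : wirtBar (fun z => c * g z) y j = c * wirtBar g y j := by
  simp only [wirtBar, conjPart, LinearMap.coe_mk, AddHom.coe_mk, fderiv_const_mul hg,
    smul_apply, smul_eq_mul]
  ring

theorem contDiffOn_wirt {n : ℕ} {g : Cn n → ℂ} {s : Set (Cn n)} (hs : IsOpen s)
    (hg : ContDiffOn ℝ ∞ g s) (j : Fin n) : ContDiffOn ℝ ∞ (fun y => wirt g y j) s := by
  have h := hg.fderiv_of_isOpen hs (m := ∞) (by simp)
  simp only [wirt, linPart, LinearMap.coe_mk, AddHom.coe_mk]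
  exact ((h.clm_apply contDiffOn_const).sub
    (contDiffOn_const.mul (h.clm_apply contDiffOn_const))).div_const _

theorem contDiffOn_wirtBar {n : ℕ} {g : Cn n → ℂ} {s : Set (Cn n)} (hs : IsOpen s)
    (hg : ContDiffOn ℝ ∞ g s) (j : Fin n) : ContDiffOn ℝ ∞ (fun y => wirtBar g y j) s := by
  have h := hg.fderiv_of_isOpen hs (m := ∞) (by simp)
  simp only [wirtBar, conjPart, LinearMap.coe_mk, AddHom.coe_mk]
  exact ((h.clm_apply contDiffOn_const).add
    (contDiffOn_const.mul (h.clm_apply contDiffOn_const))).div_const _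

/-! ### Frames, tensor fields and their components in holomorphic charts

`M` is a complex manifold modelled on `ℂⁿ`. The complex vector space `TangentSpace 𝓘(ℂ, Cn n) x`
is the holomorphic tangent space `T^{1,0}_x`. A `(0,1)`-covector at `x` is a conjugate linear
functional on it, and an element of `∧² T^{1,0}_x` is an alternating bilinear form on its dual. -/

section Fields

variable {n : ℕ} {M : Type*} [TopologicalSpace M] [ChartedSpace (Cn n) M]

/-- The fibre of the holomorphic tangent bundle `T^{1,0}`. -/
abbrev Tan (n : ℕ) {M : Type*} [TopologicalSpace M] [ChartedSpace (Cn n) M] (x : M) : Type :=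
  TangentSpace 𝓘(ℂ, Cn n) x

/-- The fibre of the bundle `T^{*(0,1)}` of `(0,1)`-forms. -/
abbrev ConjCotan (n : ℕ) {M : Type*} [TopologicalSpace M] [ChartedSpace (Cn n) M] (x : M) :
    Type :=
  Tan n x →ₛₗ[starRingEnd ℂ] ℂ

/-- The fibre of the bundle `T^{2,0} = ∧² T^{1,0}` of bivectors. -/
abbrev Biv (n : ℕ) {M : Type*} [TopologicalSpace M] [ChartedSpace (Cn n) M] (x : M) : Type :=
  (Tan n x →ₗ[ℂ] ℂ) [⋀^Fin 2]→ₗ[ℂ] ℂ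

/-- The coordinate covector `dz_i` at `x` of the chart `φ`. -/
def coframe (φ : OpenPartialHomeomorph M (Cn n)) (x : M) (i : Fin n) : Tan n x →ₗ[ℂ] ℂ :=
  coord i ∘ₗ
    (mfderiv 𝓘(ℂ, Cn n) 𝓘(ℂ, Cn n) φ x : Tan n x →L[ℂ] Cn n).toLinearMap

/-- The coordinate vector `∂/∂z_j` of the chart `φ` at the point with coordinates `y`. -/
def frame (φ : OpenPartialHomeomorph M (Cn n)) (y : Cn n) (j : Fin n) : Tan n (φ.symm y) :=
  (mfderiv 𝓘(ℂ, Cn n) 𝓘(ℂ, Cn n) φ.symm y : Cn n →L[ℂ] Tan n (φ.symm y)) (EuclideanSpace.single j 1)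

/-- The component `Z^i` of `Z = ∑ Z^i ∂/∂z_i` in the chart `φ`. -/
def vecComp (φ : OpenPartialHomeomorph M (Cn n)) (Z : ∀ x : M, Tan n x) (i : Fin n)
    (y : Cn n) : ℂ :=
  coframe φ (φ.symm y) i (Z (φ.symm y))

/-- The component `η_j` of `η = ∑ η_j dz̄_j` in the chart `φ`. -/
def formComp (φ : OpenPartialHomeomorph M (Cn n)) (η : ∀ x : M, ConjCotan n x) (j : Fin n)
    (y : Cn n) : ℂ :=
  η (φ.symm y) (frame φ y j)

/-- The component `Λ^{ij}` of `Λ = ½ ∑ Λ^{ij} ∂/∂z_i ∧ ∂/∂z_j` in the chart `φ`. -/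
def bivComp (φ : OpenPartialHomeomorph M (Cn n)) (Λ : ∀ x : M, Biv n x) (i j : Fin n)
    (y : Cn n) : ℂ :=
  Λ (φ.symm y) ![coframe φ (φ.symm y) i, coframe φ (φ.symm y) j]

end Fields

section Spaces

variable (n : ℕ) (M : Type*) [TopologicalSpace M] [ChartedSpace (Cn n) M]

/-- `C^∞(M)`: complex valued functions that are smooth in the real sense. -/
def SmoothFun : Submodule ℂ (M → ℂ) where
  carrier := {f | ContMDiff 𝓘(ℝ, Cn n) 𝓘(ℝ, ℂ) ∞ f}
  add_mem' := fun hf hg => ContMDiff.add hf hg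
  zero_mem' := contMDiff_const
  smul_mem' := fun c f hf =>
    (ContinuousLinearMap.mul ℝ ℂ c).contMDiff.comp
      (hf : ContMDiff 𝓘(ℝ, Cn n) 𝓘(ℝ, ℂ) ∞ f)

/-- `C^∞(T^{1,0})`: smooth vector fields of type `(1,0)`. -/
def SmoothVec : Submodule ℂ (∀ x : M, Tan n x) where
  carrier := {Z | ∀ φ ∈ atlas (Cn n) M, ∀ i, ContDiffOn ℝ ∞ (vecComp φ Z i) φ.target}
  add_mem' := fun hf hg φ hφ i => by
    refine ((hf φ hφ i).add (hg φ hφ i)).congr fun y _ => ?_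
    simp [vecComp]
  zero_mem' := fun φ hφ i => (contDiffOn_const (c := (0 : ℂ))).congr fun y _ => by simp [vecComp]
  smul_mem' := fun c f hf φ hφ i => by
    refine ((contDiffOn_const (c := c)).mul (hf φ hφ i)).congr fun y _ => ?_
    simp [vecComp]

/-- `C^∞(T^{*(0,1)})`: smooth `(0,1)`-forms. -/
def SmoothForm : Submodule ℂ (∀ x : M, ConjCotan n x) where
  carrier := {η | ∀ φ ∈ atlas (Cn n) M, ∀ j, ContDiffOn ℝ ∞ (formComp φ η j) φ.target}
  add_mem' := fun hf hg φ hφ i => by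
    refine ((hf φ hφ i).add (hg φ hφ i)).congr fun y _ => ?_
    simp [formComp]
  zero_mem' := fun φ hφ i => (contDiffOn_const (c := (0 : ℂ))).congr fun y _ => by simp [formComp]
  smul_mem' := fun c f hf φ hφ i => by
    refine ((contDiffOn_const (c := c)).mul (hf φ hφ i)).congr fun y _ => ?_
    simp [formComp]

/-- `C^∞(T^{2,0})`: smooth bivector fields of type `(2,0)`. -/
def SmoothBiv : Submodule ℂ (∀ x : M, Biv n x) where
  carrier := {Λ | ∀ φ ∈ atlas (Cn n) M, ∀ i j, ContDiffOn ℝ ∞ (bivComp φ Λ i j) φ.target}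
  add_mem' := fun hf hg φ hφ i j => by
    refine ((hf φ hφ i j).add (hg φ hφ i j)).congr fun y _ => ?_
    simp [bivComp]
  zero_mem' := fun φ hφ i j => (contDiffOn_const (c := (0 : ℂ))).congr fun y _ => by simp [bivComp]
  smul_mem' := fun c f hf φ hφ i j => by
    refine ((contDiffOn_const (c := c)).mul (hf φ hφ i j)).congr fun y _ => ?_
    simp [bivComp]

/-- `C^∞(L)` for `L = T^{1,0} ⊕ T^{*(0,1)}`. -/
abbrev SmoothL : Type _ := SmoothVec n M × SmoothForm n M

/-- A chart of the atlas together with (the coordinates of) a point in its domain. A tensor field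
with two indices is given below by its components, as a function on
`ChartPt n M`: one matrix for every chart and every point in the domain of the chart. -/
abbrev ChartPt : Type _ := Σ φ : atlas (Cn n) M, φ.1.target

/-- Families of components with two indices, in all charts at all points. -/
abbrev Comp2 : Type _ := ChartPt n M → Fin n → Fin n → ℂ

end Spaces

section Operators

variable {n : ℕ} {M : Type*} [TopologicalSpace M] [ChartedSpace (Cn n) M]

theorem vec_diffAt (Z : SmoothVec n M) (p : ChartPt n M) (i : Fin n) :
    DifferentiableAt ℝ (vecComp p.1.1 Z.1 i) p.2.1 :=
  ((Z.2 p.1.1 p.1.2 i).contDiffAt (p.1.1.open_target.mem_nhds p.2.2)).differentiableAt (by simp)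

theorem form_diffAt (η : SmoothForm n M) (p : ChartPt n M) (i : Fin n) :
    DifferentiableAt ℝ (formComp p.1.1 η.1 i) p.2.1 :=
  ((η.2 p.1.1 p.1.2 i).contDiffAt (p.1.1.open_target.mem_nhds p.2.2)).differentiableAt (by simp)

theorem vecComp_add (φ : OpenPartialHomeomorph M (Cn n)) (Z W : ∀ x : M, Tan n x) (i : Fin n) :
    vecComp φ (Z + W) i = fun y => vecComp φ Z i y + vecComp φ W i y := by
  funext y; simp [vecComp]

theorem vecComp_smul (φ : OpenPartialHomeomorph M (Cn n)) (c : ℂ) (Z : ∀ x : M, Tan n x)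
    (i : Fin n) : vecComp φ (c • Z) i = fun y => c * vecComp φ Z i y := by
  funext y; simp [vecComp]

theorem formComp_add (φ : OpenPartialHomeomorph M (Cn n)) (Z W : ∀ x : M, ConjCotan n x)
    (i : Fin n) : formComp φ (Z + W) i = fun y => formComp φ Z i y + formComp φ W i y := by
  funext y; simp [formComp]

theorem formComp_smul (φ : OpenPartialHomeomorph M (Cn n)) (c : ℂ) (Z : ∀ x : M, ConjCotan n x)
    (i : Fin n) : formComp φ (c • Z) i = fun y => c * formComp φ Z i y := by
  funext y; simp [formComp]

/-- `∂̄` on `C^∞(T^{1,0})`, with values in `T^{1,0} ⊗ T^{*(0,1)}`: the entry `i j` is the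
coefficient `∂Z^i/∂z̄_j` of `dz̄_j ∧ ∂/∂z_i`. -/
def dbarVec : SmoothVec n M →ₗ[ℂ] Comp2 n M where
  toFun := fun Z p i j => wirtBar (vecComp p.1.1 Z.1 i) p.2.1 j
  map_add' := fun Z W => by
    funext p i j
    simp only [Submodule.coe_add, vecComp_add, Pi.add_apply]
    exact wirtBar_add (vec_diffAt Z p i) (vec_diffAt W p i) j
  map_smul' := fun c Z => by
    funext p i j
    simp only [Submodule.coe_smul, vecComp_smul, Pi.smul_apply]
    exact wirtBar_const_mul (vec_diffAt Z p i) c j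

/-- `∂̄` on `(0,1)`-forms, with values in `T^{*(0,2)}`: the entry `j k` is
`∂η_k/∂z̄_j - ∂η_j/∂z̄_k`. -/
def dbarForm : SmoothForm n M →ₗ[ℂ] Comp2 n M where
  toFun := fun η p j k =>
    wirtBar (formComp p.1.1 η.1 k) p.2.1 j - wirtBar (formComp p.1.1 η.1 j) p.2.1 k
  map_add' := fun Z W => by
    funext p j k
    simp only [Submodule.coe_add, formComp_add, Pi.add_apply]
    rw [wirtBar_add (form_diffAt Z p k) (form_diffAt W p k) j, wirtBar_add (form_diffAt Z p j) (form_diffAt W p j) k]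
    ring
  map_smul' := fun c Z => by
    funext p j k
    simp only [Submodule.coe_smul, formComp_smul, Pi.smul_apply, RingHom.id_apply, smul_eq_mul]
    rw [wirtBar_const_mul (form_diffAt Z p k), wirtBar_const_mul (form_diffAt Z p j)]
    ring

/-- The Schouten bracket `[Λ, Z] = - L_Z Λ` in `T^{2,0}`: the entry `i j` is
`∑_k (Λ^{kj} ∂Z^i/∂z_k + Λ^{ik} ∂Z^j/∂z_k - Z^k ∂Λ^{ij}/∂z_k)`. -/
def schoutenVec (Λ : SmoothBiv n M) : SmoothVec n M →ₗ[ℂ] Comp2 n M where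
  toFun := fun Z p i j => ∑ k,
    (bivComp p.1.1 Λ.1 k j p.2.1 * wirt (vecComp p.1.1 Z.1 i) p.2.1 k
      + bivComp p.1.1 Λ.1 i k p.2.1 * wirt (vecComp p.1.1 Z.1 j) p.2.1 k
      - vecComp p.1.1 Z.1 k p.2.1 * wirt (bivComp p.1.1 Λ.1 i j) p.2.1 k)
  map_add' := fun Z W => by
    funext p i j
    simp only [Submodule.coe_add, vecComp_add, Pi.add_apply, ← Finset.sum_add_distrib]
    refine Finset.sum_congr rfl fun k _ => ?_
    rw [wirt_add (vec_diffAt Z p i) (vec_diffAt W p i) k, wirt_add (vec_diffAt Z p j) (vec_diffAt W p j) k]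
    ring
  map_smul' := fun c Z => by
    funext p i j
    simp only [Submodule.coe_smul, vecComp_smul, Pi.smul_apply, RingHom.id_apply, smul_eq_mul,
      Finset.mul_sum]
    refine Finset.sum_congr rfl fun k _ => ?_
    rw [wirt_const_mul (vec_diffAt Z p i), wirt_const_mul (vec_diffAt Z p j)]
    ring

/-- The Schouten bracket `[Λ, η]` in `T^{1,0} ⊗ T^{*(0,1)}`: from `[X, η] = L_X η` and
`[X ∧ Y, η] = X ∧ [Y, η] + [X, η] ∧ Y` the coefficient of `dz̄_j ∧ ∂/∂z_i` is
`- ∑_k Λ^{ik} ∂η_j/∂z_k`. -/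
def schoutenForm (Λ : SmoothBiv n M) : SmoothForm n M →ₗ[ℂ] Comp2 n M where
  toFun := fun η p i j =>
    - ∑ k, bivComp p.1.1 Λ.1 i k p.2.1 * wirt (formComp p.1.1 η.1 j) p.2.1 k
  map_add' := fun Z W => by
    funext p i j
    simp only [Submodule.coe_add, formComp_add, Pi.add_apply, ← neg_add,
      ← Finset.sum_add_distrib]
    congr 1
    refine Finset.sum_congr rfl fun k _ => ?_
    rw [wirt_add (form_diffAt Z p j) (form_diffAt W p j) k]
    ring
  map_smul' := fun c Z => by
    funext p i j
    simp only [Submodule.coe_smul, formComp_smul, Pi.smul_apply, RingHom.id_apply, smul_eq_mul,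
      Finset.mul_sum, mul_neg]
    congr 1
    refine Finset.sum_congr rfl fun k _ => ?_
    rw [wirt_const_mul (form_diffAt Z p j)]
    ring

/-- `Λ` is a holomorphic Poisson structure: `∂̄Λ = 0` and `[Λ, Λ] = 0`. The bracket `[Λ, Λ]` is
the trivector field with components
`2 ∑_l (Λ^{il} ∂Λ^{jk}/∂z_l + Λ^{jl} ∂Λ^{ki}/∂z_l + Λ^{kl} ∂Λ^{ij}/∂z_l)`. -/
structure IsHolomorphicPoisson (Λ : SmoothBiv n M) : Prop where
  dbar_eq_zero : ∀ (p : ChartPt n M) (i j k : Fin n),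
    wirtBar (bivComp p.1.1 Λ.1 i j) p.2.1 k = 0
  schouten_self_eq_zero : ∀ (p : ChartPt n M) (i j k : Fin n),
    2 * ∑ l, (bivComp p.1.1 Λ.1 i l p.2.1 * wirt (bivComp p.1.1 Λ.1 j k) p.2.1 l
      + bivComp p.1.1 Λ.1 j l p.2.1 * wirt (bivComp p.1.1 Λ.1 k i) p.2.1 l
      + bivComp p.1.1 Λ.1 k l p.2.1 * wirt (bivComp p.1.1 Λ.1 i j) p.2.1 l) = 0

/-- The differential of a smooth function at `x`. -/
def realDeriv (f : M → ℂ) (x : M) : Cn n →L[ℝ] ℂ :=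
  mfderiv 𝓘(ℝ, Cn n) 𝓘(ℝ, ℂ) f x

/-- The `(1,0)`-form `∂f` at `x`. -/
def delAt (n : ℕ) {M : Type*} [TopologicalSpace M] [ChartedSpace (Cn n) M] (f : M → ℂ) (x : M) :
    Tan n x →ₗ[ℂ] ℂ :=
  linPart (realDeriv f x)

/-- The `(0,1)`-form `∂̄f` at `x`. -/
def dbarAt (n : ℕ) {M : Type*} [TopologicalSpace M] [ChartedSpace (Cn n) M] (f : M → ℂ) (x : M) :
    ConjCotan n x :=
  conjPart (realDeriv f x)

/-- The Schouten bracket `[Λ, f]` at `x`: the vector with `α([Λ, f]) = Λ(α, ∂f)` for all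
covectors `α`, in accordance with `[X ∧ Y, f] = Y(f) X - X(f) Y`. The vector is written through
the coordinates on the tangent space at `x`. -/
def schoutenAt (Λ : ∀ x : M, Biv n x) (f : M → ℂ) (x : M) : Tan n x :=
  (WithLp.toLp 2 fun i => Λ x ![coord i, delAt n f x] : Cn n)

/-- The characterization of `[Λ, f]` by its pairing with covectors. -/
theorem apply_schoutenAt (Λ : ∀ x : M, Biv n x) (f : M → ℂ) (x : M) (α : Tan n x →ₗ[ℂ] ℂ) :
    α (schoutenAt Λ f x) = Λ x ![α, delAt n f x] := by
  have h : ∀ (B : (Cn n →ₗ[ℂ] ℂ) [⋀^Fin 2]→ₗ[ℂ] ℂ) (α β : Cn n →ₗ[ℂ] ℂ),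
      α (WithLp.toLp 2 fun i => B ![coord i, β]) = B ![α, β] := by
    intro B α β
    have h1 := alt_left B (fun i => α (EuclideanSpace.single i 1)) (fun i => coord i) β
    rw [← dual_eq_sum α] at h1
    rw [h1, eq_sum_single (WithLp.toLp 2 fun i => B ![coord i, β])]
    simp only [map_sum, map_smul, smul_eq_mul]
    exact Finset.sum_congr rfl fun k _ => mul_comm _ _
  exact h _ _ _

/-- The real manifold underlying a complex manifold. -/
theorem isManifold_real [h : IsManifold 𝓘(ℂ, Cn n) ω M] : IsManifold 𝓘(ℝ, Cn n) ∞ M := by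
  refine isManifold_of_contDiffOn _ _ _ fun e e' he he' => ?_
  have h2 := h.compatible he he'
  rw [contDiffGroupoid, mem_groupoid_of_pregroupoid] at h2
  have h3 : ContDiffOn ℂ ω (𝓘(ℂ, Cn n) ∘ e.symm ≫ₕ e' ∘ 𝓘(ℂ, Cn n).symm)
    (𝓘(ℂ, Cn n).symm ⁻¹' (e.symm ≫ₕ e').source ∩ Set.range 𝓘(ℂ, Cn n)) := h2.1
  exact (h3.of_le le_top).restrict_scalars ℝ

theorem hasFDerivWithinAt_real {F : Cn n → Cn n} {A : Cn n →L[ℂ] Cn n} {s : Set (Cn n)}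
    {y : Cn n} (h : HasFDerivWithinAt F A s y) :
    HasFDerivWithinAt F (A.restrictScalars ℝ) s y :=
  h.restrictScalars ℝ

/-- The derivative of the inverse of the chart `φ`, as an endomorphism of `ℂⁿ`. -/
def symmDeriv (φ : OpenPartialHomeomorph M (Cn n)) (y : Cn n) : Cn n →L[ℂ] Cn n :=
  mfderiv 𝓘(ℂ, Cn n) 𝓘(ℂ, Cn n) φ.symm y

theorem realDeriv_symm [IsManifold 𝓘(ℂ, Cn n) ω M] {f : M → ℂ} (hf : f ∈ SmoothFun n M)
    {φ : OpenPartialHomeomorph M (Cn n)} (hφ : φ ∈ atlas (Cn n) M) {y : Cn n}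
    (hy : y ∈ φ.target) (v : Cn n) :
    realDeriv f (φ.symm y) (symmDeriv φ y v) = fderiv ℝ (f ∘ φ.symm) y v := by
  have h1 : HasMFDerivAt 𝓘(ℂ, Cn n) 𝓘(ℂ, Cn n) φ.symm y (symmDeriv φ y) :=
    (mdifferentiableAt_atlas_symm hφ hy).hasMFDerivAt
  have h12 : HasFDerivWithinAt (writtenInExtChartAt 𝓘(ℂ, Cn n) 𝓘(ℂ, Cn n) y φ.symm)
      (symmDeriv φ y) (Set.range 𝓘(ℂ, Cn n)) (extChartAt 𝓘(ℂ, Cn n) y y) := h1.2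
  have h2 : HasMFDerivAt 𝓘(ℝ, Cn n) 𝓘(ℝ, Cn n) φ.symm y ((symmDeriv φ y).restrictScalars ℝ) :=
    ⟨h1.1, hasFDerivWithinAt_real h12⟩
  have h3 : HasMFDerivAt 𝓘(ℝ, Cn n) 𝓘(ℝ, ℂ) f (φ.symm y) (realDeriv f (φ.symm y)) :=
    (ContMDiff.mdifferentiableAt hf (by simp)).hasMFDerivAt
  have h4 : HasMFDerivAt 𝓘(ℝ, Cn n) 𝓘(ℝ, ℂ) (f ∘ φ.symm) y
      ((realDeriv f (φ.symm y)).comp ((symmDeriv φ y).restrictScalars ℝ)) := h3.comp y h2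
  have h5 : HasFDerivAt (f ∘ φ.symm)
      ((realDeriv f (φ.symm y)).comp ((symmDeriv φ y).restrictScalars ℝ)) y :=
    hasMFDerivAt_iff_hasFDerivAt.1 h4
  rw [h5.fderiv]
  rfl

theorem contDiffOn_comp_symm [IsManifold 𝓘(ℂ, Cn n) ω M] {f : M → ℂ} (hf : f ∈ SmoothFun n M)
    {φ : OpenPartialHomeomorph M (Cn n)} (hφ : φ ∈ atlas (Cn n) M) :
    ContDiffOn ℝ ∞ (f ∘ φ.symm) φ.target := by
  have : IsManifold 𝓘(ℝ, Cn n) ∞ M := isManifold_real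
  have h := contMDiffOn_symm_of_mem_maximalAtlas
    (IsManifold.subset_maximalAtlas (I := 𝓘(ℝ, Cn n)) (n := ∞) hφ)
  exact contMDiffOn_iff_contDiffOn.1 (ContMDiff.comp_contMDiffOn hf h)

/-- In a chart, `∂̄f = ∑_j ∂f/∂z̄_j dz̄_j`. -/
theorem formComp_dbarAt [IsManifold 𝓘(ℂ, Cn n) ω M] {f : M → ℂ} (hf : f ∈ SmoothFun n M)
    {φ : OpenPartialHomeomorph M (Cn n)} (hφ : φ ∈ atlas (Cn n) M) {y : Cn n}
    (hy : y ∈ φ.target) (j : Fin n) :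
    formComp φ (dbarAt n f) j y = wirtBar (f ∘ φ.symm) y j :=
  conjPart_comp _ _ (symmDeriv φ y) (realDeriv_symm hf hφ hy) _

theorem delAt_symmDeriv [IsManifold 𝓘(ℂ, Cn n) ω M] {f : M → ℂ} (hf : f ∈ SmoothFun n M)
    {φ : OpenPartialHomeomorph M (Cn n)} (hφ : φ ∈ atlas (Cn n) M) {y : Cn n}
    (hy : y ∈ φ.target) (v : Cn n) :
    delAt n f (φ.symm y) (symmDeriv φ y v) = linPart (fderiv ℝ (f ∘ φ.symm) y) v :=
  linPart_comp _ _ (symmDeriv φ y) (realDeriv_symm hf hφ hy) _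

/-- In a chart, `∂f = ∑_k ∂f/∂z_k dz_k`. -/
theorem delAt_eq_sum [IsManifold 𝓘(ℂ, Cn n) ω M] {f : M → ℂ} (hf : f ∈ SmoothFun n M)
    {φ : OpenPartialHomeomorph M (Cn n)} (hφ : φ ∈ atlas (Cn n) M) {y : Cn n}
    (hy : y ∈ φ.target) :
    delAt n f (φ.symm y) = ∑ k, wirt (f ∘ φ.symm) y k • coframe φ (φ.symm y) k := by
  have hd : φ.MDifferentiable 𝓘(ℂ, Cn n) 𝓘(ℂ, Cn n) := mdifferentiable_of_mem_atlas hφ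
  have hx : φ.symm y ∈ φ.source := φ.map_target hy
  refine LinearMap.ext fun v => ?_
  have h := DFunLike.congr_fun (hd.symm_comp_deriv hx) v
  rw [φ.right_inv hy] at h
  let u : Cn n := (mfderiv 𝓘(ℂ, Cn n) 𝓘(ℂ, Cn n) φ (φ.symm y) : Tan n (φ.symm y) →L[ℂ] Cn n) v
  have hv : symmDeriv φ y u = v := h
  conv_lhs => rw [← hv]
  rw [delAt_symmDeriv hf hφ hy, dual_eq_sum (linPart _), LinearMap.sum_apply,
    LinearMap.sum_apply]
  rfl

/-- In a chart, `[Λ, f] = ∑_i (∑_k Λ^{ik} ∂f/∂z_k) ∂/∂z_i`. -/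
theorem vecComp_schoutenAt [IsManifold 𝓘(ℂ, Cn n) ω M] (Λ : ∀ x : M, Biv n x) {f : M → ℂ}
    (hf : f ∈ SmoothFun n M)
    {φ : OpenPartialHomeomorph M (Cn n)} (hφ : φ ∈ atlas (Cn n) M) {y : Cn n}
    (hy : y ∈ φ.target) (i : Fin n) :
    vecComp φ (schoutenAt Λ f) i y = ∑ k, bivComp φ Λ i k y * wirt (f ∘ φ.symm) y k := by
  rw [vecComp, apply_schoutenAt, delAt_eq_sum hf hφ hy, alt_right]
  exact Finset.sum_congr rfl fun k _ => mul_comm (wirt (f ∘ φ.symm) y k) (bivComp φ Λ i k y)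

theorem realDeriv_add {f g : M → ℂ} (hf : f ∈ SmoothFun n M) (hg : g ∈ SmoothFun n M) (x : M) :
    (realDeriv (f + g) x : Cn n →L[ℝ] ℂ) = realDeriv f x + realDeriv g x :=
  ((ContMDiff.mdifferentiableAt hf (by simp)).hasMFDerivAt.add
    (ContMDiff.mdifferentiableAt hg (by simp)).hasMFDerivAt).mfderiv

theorem realDeriv_smul (c : ℂ) {f : M → ℂ} (hf : f ∈ SmoothFun n M) (x : M) :
    (realDeriv (c • f) x : Cn n →L[ℝ] ℂ) = c • realDeriv f x := by
  have h : HasMFDerivAt 𝓘(ℝ, Cn n) 𝓘(ℝ, ℂ) f x (realDeriv f x) :=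
    (ContMDiff.mdifferentiableAt hf (by simp)).hasMFDerivAt
  have h2 : HasMFDerivAt 𝓘(ℝ, ℂ) 𝓘(ℝ, ℂ) (fun z : ℂ => c * z) (f x)
      (ContinuousLinearMap.mul ℝ ℂ c) := (ContinuousLinearMap.mul ℝ ℂ c).hasMFDerivAt
  exact (h2.comp x h).mfderiv

/-- `∂̄ : C^∞(M) → C^∞(T^{*(0,1)})`. -/
def dbarFun [IsManifold 𝓘(ℂ, Cn n) ω M] : SmoothFun n M →ₗ[ℂ] SmoothForm n M where
  toFun := fun f => ⟨dbarAt n f.1, fun φ hφ j =>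
    (contDiffOn_wirtBar φ.open_target (contDiffOn_comp_symm f.2 hφ) j).congr
      fun _ hy => formComp_dbarAt f.2 hφ hy j⟩
  map_add' := fun f g => Subtype.ext <| funext fun x =>
    (congrArg conjPart (realDeriv_add f.2 g.2 x)).trans (conjPart_add _ _)
  map_smul' := fun c f => Subtype.ext <| funext fun x =>
    (congrArg conjPart (realDeriv_smul c f.2 x)).trans (conjPart_smul _ _)

theorem schoutenAt_add (Λ : ∀ x : M, Biv n x) {f g : M → ℂ} (hf : f ∈ SmoothFun n M)
    (hg : g ∈ SmoothFun n M) (x : M) :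
    schoutenAt Λ (f + g) x = schoutenAt Λ f x + schoutenAt Λ g x := by
  have h : delAt n (f + g) x = delAt n f x + delAt n g x :=
    (congrArg linPart (realDeriv_add hf hg x)).trans (linPart_add _ _)
  refine PiLp.ext fun i => ?_
  have h1 := alt_right (Λ x) ![1, 1] ![delAt n f x, delAt n g x]
    (coord i)
  simp only [Fin.sum_univ_two, Matrix.cons_val_zero, Matrix.cons_val_one, one_smul, one_mul,
    ← h] at h1
  exact h1

theorem schoutenAt_smul (Λ : ∀ x : M, Biv n x) (c : ℂ) {f : M → ℂ} (hf : f ∈ SmoothFun n M)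
    (x : M) : schoutenAt Λ (c • f) x = c • schoutenAt Λ f x := by
  have h : delAt n (c • f) x = c • delAt n f x :=
    (congrArg linPart (realDeriv_smul c hf x)).trans (linPart_smul _ _)
  refine PiLp.ext fun i => ?_
  have h1 := alt_right (Λ x) ![c] ![delAt n f x] (coord i)
  simp only [Fin.sum_univ_one, Matrix.cons_val_zero, ← h] at h1
  exact h1

/-- `[Λ, -] : C^∞(M) → C^∞(T^{1,0})`. -/
def schoutenFun [IsManifold 𝓘(ℂ, Cn n) ω M] (Λ : SmoothBiv n M) :
    SmoothFun n M →ₗ[ℂ] SmoothVec n M where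
  toFun := fun f => ⟨schoutenAt Λ.1 f.1, fun φ hφ i =>
    (ContDiffOn.sum (s := Finset.univ) fun k _ => (Λ.2 φ hφ i k).mul
      (contDiffOn_wirt φ.open_target (contDiffOn_comp_symm f.2 hφ) k)).congr
      fun _ hy => vecComp_schoutenAt Λ.1 f.2 hφ hy i⟩
  map_add' := fun f g => Subtype.ext <| funext fun x => schoutenAt_add Λ.1 f.2 g.2 x
  map_smul' := fun c f => Subtype.ext <| funext fun x => schoutenAt_smul Λ.1 c f.2 x

end Operators

/-! ### Cohomology of a pair of linear maps -/

section Cohomology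

variable {A B C : Type*} [AddCommGroup A] [Module ℂ A] [AddCommGroup B] [Module ℂ B]
  [AddCommGroup C] [Module ℂ C]

/-- The cohomology `ker d₁ / im d₀` of `d₀ : A → B` and `d₁ : B → C`. -/
def Cohomology (d₀ : A →ₗ[ℂ] B) (d₁ : B →ₗ[ℂ] C) : Type _ :=
  LinearMap.ker d₁ ⧸ (LinearMap.range d₀).submoduleOf (LinearMap.ker d₁)

instance (d₀ : A →ₗ[ℂ] B) (d₁ : B →ₗ[ℂ] C) : AddCommGroup (Cohomology d₀ d₁) :=
  inferInstanceAs
    (AddCommGroup (LinearMap.ker d₁ ⧸ (LinearMap.range d₀).submoduleOf (LinearMap.ker d₁)))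

instance (d₀ : A →ₗ[ℂ] B) (d₁ : B →ₗ[ℂ] C) : Module ℂ (Cohomology d₀ d₁) :=
  inferInstanceAs
    (Module ℂ (LinearMap.ker d₁ ⧸ (LinearMap.range d₀).submoduleOf (LinearMap.ker d₁)))

/-- The cohomology class of a cocycle. -/
def cohomologyClass (d₀ : A →ₗ[ℂ] B) (d₁ : B →ₗ[ℂ] C) (b : B) (hb : d₁ b = 0) :
    Cohomology d₀ d₁ :=
  Submodule.Quotient.mk ⟨b, LinearMap.mem_ker.2 hb⟩

end Cohomology

/-! ### The complex of `∂̄_Λ = ∂̄ + [Λ, -]` in degrees `0, 1, 2`, and Dolbeault cohomology -/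

section Complex

variable {n : ℕ} {M : Type*} [TopologicalSpace M] [ChartedSpace (Cn n) M]

variable (n M) in
/-- Components of sections of `∧² L = T^{2,0} ⊕ (T^{1,0} ⊗ T^{*(0,1)}) ⊕ T^{*(0,2)}`. -/
abbrev WedgeComp : Type _ := Comp2 n M × Comp2 n M × Comp2 n M

/-- `∂̄` on `C^∞(L)`: `Z + η ↦ 0 + ∂̄Z + ∂̄η`. -/
def dbarOne : SmoothL n M →ₗ[ℂ] WedgeComp n M :=
  LinearMap.prod 0
    (LinearMap.prod (dbarVec ∘ₗ LinearMap.fst ℂ _ _) (dbarForm ∘ₗ LinearMap.snd ℂ _ _))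

/-- `[Λ, -]` on `C^∞(L)`: `Z + η ↦ [Λ, Z] + [Λ, η] + 0`. -/
def schoutenOne (Λ : SmoothBiv n M) : SmoothL n M →ₗ[ℂ] WedgeComp n M :=
  LinearMap.prod (schoutenVec Λ ∘ₗ LinearMap.fst ℂ _ _)
    (LinearMap.prod (schoutenForm Λ ∘ₗ LinearMap.snd ℂ _ _) 0)

/-- `∂̄_Λ = ∂̄ + [Λ, -]` on `C^∞(L)`. -/
def dbarLambdaOne (Λ : SmoothBiv n M) : SmoothL n M →ₗ[ℂ] WedgeComp n M :=
  dbarOne + schoutenOne Λ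

/-- The space of holomorphic vector fields `W ∈ H⁰(M, T^{1,0})`, i.e. `∂̄W = 0`, that
satisfy `[Λ, W] = 0`. -/
def poissonFields (Λ : SmoothBiv n M) : Submodule ℂ (SmoothVec n M) :=
  LinearMap.ker dbarVec ⊓ LinearMap.ker (schoutenVec Λ)

variable [IsManifold 𝓘(ℂ, Cn n) ω M]

/-- `∂̄` on `C^∞(M)` with values in `C^∞(L)`: `f ↦ 0 + ∂̄f`. -/
def dbarZero : SmoothFun n M →ₗ[ℂ] SmoothL n M :=
  LinearMap.inr ℂ _ _ ∘ₗ dbarFun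

/-- `[Λ, -]` on `C^∞(M)` with values in `C^∞(L)`: `f ↦ [Λ, f] + 0`. -/
def schoutenZero (Λ : SmoothBiv n M) : SmoothFun n M →ₗ[ℂ] SmoothL n M :=
  LinearMap.inl ℂ _ _ ∘ₗ schoutenFun Λ

/-- `∂̄_Λ = ∂̄ + [Λ, -]` on `C^∞(M)`. -/
def dbarLambdaZero (Λ : SmoothBiv n M) : SmoothFun n M →ₗ[ℂ] SmoothL n M :=
  dbarZero + schoutenZero Λ

/-- The first cohomology of `∂̄_Λ`: the kernel of `∂̄_Λ` on `C^∞(L)` modulo the image of `∂̄_Λ`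
on `C^∞(M)`. -/
abbrev H1Lambda (Λ : SmoothBiv n M) : Type _ :=
  Cohomology (dbarLambdaZero Λ) (dbarLambdaOne Λ)

variable (n M) in
/-- The Dolbeault cohomology `H¹(M, 𝒪)`: smooth `∂̄`-closed `(0,1)`-forms modulo `∂̄f` for smooth
functions `f`. -/
abbrev DolbeaultH1 : Type _ :=
  Cohomology (dbarFun : SmoothFun n M →ₗ[ℂ] SmoothForm n M)
    (dbarForm : SmoothForm n M →ₗ[ℂ] Comp2 n M)

end Complex

end HolPoisson

end

/-!
A `∂̄_Λ`-cocycle `Z + η` has `∂̄η = 0`, so `η = ∂̄f` because `H¹(M, 𝒪) = 0`. Subtracting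
`∂̄_Λ f = [Λ, f] + ∂̄f`, which is a cocycle because `∂̄_Λ² = 0`, leaves the cohomologous section
`Z - [Λ, f]` of `T^{1,0}`; a cocycle without form part is exactly a holomorphic vector field
commuting with `Λ`. Such a field is exact only if it is `[Λ, f]` with `∂̄f = 0`, and this vanishes
on a compact manifold, where holomorphic functions are locally constant.
-/

noncomputable section

namespace HolPoisson

open Filter
open scoped Topology

/-! ### Derivatives along complexified vectors -/

section ComplexDeriv

variable {E : Type*} [NormedAddCommGroup E] [NormedSpace ℝ E]

/-- The derivative of `g` at `y` along the element `u + i v` of the complexification `E ⊗ ℂ`. Both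
Wirtinger derivatives are instances, so that the rules of calculus need only be proved once. -/
def complexDeriv (u v : E) (g : E → ℂ) (y : E) : ℂ :=
  fderiv ℝ g y u + Complex.I * fderiv ℝ g y v

theorem complexDeriv_sum_mul {ι : Type*} (s : Finset ι) {g h : ι → E → ℂ} {y : E}
    (hg : ∀ k ∈ s, DifferentiableAt ℝ (g k) y) (hh : ∀ k ∈ s, DifferentiableAt ℝ (h k) y)
    (u v : E) :
    complexDeriv u v (fun z => ∑ k ∈ s, g k z * h k z) y =
      ∑ k ∈ s, (g k y * complexDeriv u v (h k) y + h k y * complexDeriv u v (g k) y) := by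
  simp only [complexDeriv, fderiv_fun_sum fun k hk => (hg k hk).fun_mul (hh k hk), sum_apply,
    Finset.mul_sum, ← Finset.sum_add_distrib]
  refine Finset.sum_congr rfl fun k hk => ?_
  rw [fderiv_fun_mul (hg k hk) (hh k hk)]
  simp only [add_apply, smul_apply, smul_eq_mul]
  ring

theorem fderiv_complexDeriv {g : E → ℂ} {y : E} (hg : DifferentiableAt ℝ (fderiv ℝ g) y)
    (u v w : E) :
    fderiv ℝ (complexDeriv u v g) y w =
      fderiv ℝ (fderiv ℝ g) y w u + Complex.I * fderiv ℝ (fderiv ℝ g) y w v := by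
  have hd (x : E) := hg.hasFDerivAt.clm_apply (hasFDerivAt_const x y)
  have h : HasFDerivAt (complexDeriv u v g) _ y := (hd u).add ((hd v).const_mul Complex.I)
  simp [h.fderiv]

theorem complexDeriv_comm {g : E → ℂ} {y : E} (hg : ContDiffAt ℝ 2 g y) (u v u' v' : E) :
    complexDeriv u' v' (complexDeriv u v g) y = complexDeriv u v (complexDeriv u' v' g) y := by
  have hd : DifferentiableAt ℝ (fderiv ℝ g) y :=
    (hg.fderiv_right (m := 1) (by norm_num)).differentiableAt one_ne_zero
  have hsymm : IsSymmSndFDerivAt ℝ g y := hg.isSymmSndFDerivAt (by simp)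
  rw [complexDeriv, complexDeriv]
  simp only [fderiv_complexDeriv hd]
  rw [hsymm u' u, hsymm u' v, hsymm v' u, hsymm v' v]
  ring

end ComplexDeriv

section Wirtinger

variable {n : ℕ} {g h : Cn n → ℂ} {y : Cn n}

theorem wirt_eq_complexDeriv (g : Cn n → ℂ) (y : Cn n) (j : Fin n) :
    wirt g y j = complexDeriv ((2⁻¹ : ℝ) • EuclideanSpace.single j 1)
      (-(2⁻¹ : ℝ) • Complex.I • EuclideanSpace.single j 1) g y := by
  simp only [wirt, linPart, complexDeriv, LinearMap.coe_mk, AddHom.coe_mk, map_smul,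
    Complex.real_smul]
  push_cast
  ring

theorem wirtBar_eq_complexDeriv (g : Cn n → ℂ) (y : Cn n) (j : Fin n) :
    wirtBar g y j = complexDeriv ((2⁻¹ : ℝ) • EuclideanSpace.single j 1)
      ((2⁻¹ : ℝ) • Complex.I • EuclideanSpace.single j 1) g y := by
  simp only [wirtBar, conjPart, complexDeriv, LinearMap.coe_mk, AddHom.coe_mk, map_smul,
    Complex.real_smul]
  push_cast
  ring

theorem wirt_sum_mul {ι : Type*} (s : Finset ι) {g h : ι → Cn n → ℂ}
    (hg : ∀ k ∈ s, DifferentiableAt ℝ (g k) y) (hh : ∀ k ∈ s, DifferentiableAt ℝ (h k) y)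
    (j : Fin n) :
    wirt (fun z => ∑ k ∈ s, g k z * h k z) y j =
      ∑ k ∈ s, (g k y * wirt (h k) y j + h k y * wirt (g k) y j) := by
  simpa only [wirt_eq_complexDeriv] using complexDeriv_sum_mul s hg hh _ _

theorem wirtBar_sum_mul {ι : Type*} (s : Finset ι) {g h : ι → Cn n → ℂ}
    (hg : ∀ k ∈ s, DifferentiableAt ℝ (g k) y) (hh : ∀ k ∈ s, DifferentiableAt ℝ (h k) y)
    (j : Fin n) :
    wirtBar (fun z => ∑ k ∈ s, g k z * h k z) y j =
      ∑ k ∈ s, (g k y * wirtBar (h k) y j + h k y * wirtBar (g k) y j) := by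
  simpa only [wirtBar_eq_complexDeriv] using complexDeriv_sum_mul s hg hh _ _

theorem wirt_neg (g : Cn n → ℂ) (y : Cn n) (j : Fin n) : wirt (-g) y j = -wirt g y j := by
  simp only [wirt_eq_complexDeriv, complexDeriv, fderiv_neg, neg_apply]
  ring

theorem wirt_congr (hgh : g =ᶠ[𝓝 y] h) (j : Fin n) : wirt g y j = wirt h y j := by
  rw [wirt, wirt, hgh.fderiv_eq]

theorem wirtBar_congr (hgh : g =ᶠ[𝓝 y] h) (j : Fin n) : wirtBar g y j = wirtBar h y j := by
  rw [wirtBar, wirtBar, hgh.fderiv_eq]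

theorem wirt_wirt_comm (hg : ContDiffAt ℝ 2 g y) (j k : Fin n) :
    wirt (fun z => wirt g z j) y k = wirt (fun z => wirt g z k) y j := by
  simpa only [wirt_eq_complexDeriv] using complexDeriv_comm hg _ _ _ _

theorem wirtBar_wirtBar_comm (hg : ContDiffAt ℝ 2 g y) (j k : Fin n) :
    wirtBar (fun z => wirtBar g z j) y k = wirtBar (fun z => wirtBar g z k) y j := by
  simpa only [wirtBar_eq_complexDeriv] using complexDeriv_comm hg _ _ _ _

theorem wirtBar_wirt_comm (hg : ContDiffAt ℝ 2 g y) (j k : Fin n) :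
    wirtBar (fun z => wirt g z j) y k = wirt (fun z => wirtBar g z k) y j := by
  simpa only [wirt_eq_complexDeriv, wirtBar_eq_complexDeriv] using complexDeriv_comm hg _ _ _ _

end Wirtinger

/-! ### The square of `∂̄_Λ` on functions -/

section Contraction

variable {ι R : Type*} [Fintype ι] [CommRing R]

theorem sum_hessian_eq_zero {b s : ι → ι → R} (hb : ∀ k l, b l k = -b k l)
    (hs : ∀ k l, s k l = s l k) (i j : ι) :
    ∑ k, ∑ l, (b k j * b i l * s l k + b i k * b j l * s l k) = 0 := by
  have hcross : ∑ k, ∑ l, b i k * b j l * s l k = ∑ k, ∑ l, -(b k j * b i l * s l k) := by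
    rw [Finset.sum_comm]
    refine Finset.sum_congr rfl fun k _ => Finset.sum_congr rfl fun l _ => ?_
    rw [hb k j, hs k l]
    ring
  simp only [Finset.sum_add_distrib, hcross, Finset.sum_neg_distrib, add_neg_cancel]

/-- With `b i j = Λ^{ij}`, `d i j k = ∂Λ^{ij}/∂z_k`, `t l = ∂f/∂z_l` and `s l k = ∂²f/∂z_l∂z_k`,
this is the component form of `[Λ, [Λ, f]] = ½ ι_{∂f} [Λ, Λ]`. -/
theorem sum_bracket_bracket_eq {b s : ι → ι → R} {d : ι → ι → ι → R} (t : ι → R)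
    (hb : ∀ k l, b l k = -b k l) (hd : ∀ k l m, d l k m = -d k l m)
    (hs : ∀ k l, s k l = s l k) (i j : ι) :
    ∑ k, (b k j * ∑ l, (b i l * s l k + t l * d i l k)
        + b i k * ∑ l, (b j l * s l k + t l * d j l k) - (∑ l, b k l * t l) * d i j k) =
      ∑ l, t l * ∑ k, (b i k * d j l k + b j k * d l i k + b l k * d i j k) := by
  calc _ = ∑ k, ∑ l, (b k j * b i l * s l k + b i k * b j l * s l k)
        + ∑ k, ∑ l, t l * (b i k * d j l k + b j k * d l i k + b l k * d i j k) := by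
        simp only [← Finset.sum_add_distrib, Finset.mul_sum, Finset.sum_mul,
          ← Finset.sum_sub_distrib]
        refine Finset.sum_congr rfl fun k _ => Finset.sum_congr rfl fun l _ => ?_
        rw [hb j k, hb k l, hd i l]
        ring
    _ = _ := by
        rw [sum_hessian_eq_zero hb hs, zero_add, Finset.sum_comm]
        simp only [Finset.mul_sum]

end Contraction

section Square

variable {n : ℕ} {M : Type*} [TopologicalSpace M] [ChartedSpace (Cn n) M]

theorem bivComp_swap (φ : OpenPartialHomeomorph M (Cn n)) (Λ : ∀ x : M, Biv n x) (i j : Fin n) :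
    bivComp φ Λ j i = -bivComp φ Λ i j := by
  funext y
  have hswap := (Λ (φ.symm y)).map_swap ![coframe φ (φ.symm y) i, coframe φ (φ.symm y) j]
    (i := 0) (j := 1) zero_ne_one
  rw [Pi.neg_apply, bivComp, bivComp, ← hswap]
  congr 1
  ext k : 1
  fin_cases k <;> rfl

theorem contDiffAt_of_contDiffOn_target {g : Cn n → ℂ} (p : ChartPt n M)
    (hg : ContDiffOn ℝ ∞ g p.1.1.target) : ContDiffAt ℝ ∞ g p.2.1 :=
  hg.contDiffAt (p.1.1.open_target.mem_nhds p.2.2)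

theorem biv_diffAt (Λ : SmoothBiv n M) (p : ChartPt n M) (i j : Fin n) :
    DifferentiableAt ℝ (bivComp p.1.1 Λ.1 i j) p.2.1 :=
  (contDiffAt_of_contDiffOn_target p (Λ.2 p.1.1 p.1.2 i j)).differentiableAt (by simp)

theorem dbarLambdaOne_apply (Λ : SmoothBiv n M) (Z : SmoothVec n M) (η : SmoothForm n M) :
    dbarLambdaOne Λ (Z, η) = (schoutenVec Λ Z, dbarVec Z + schoutenForm Λ η, dbarForm η) := by
  simp [dbarLambdaOne, dbarOne, schoutenOne]

variable [IsManifold 𝓘(ℂ, Cn n) ω M]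

theorem contDiffAt_comp_symm (f : SmoothFun n M) (p : ChartPt n M) :
    ContDiffAt ℝ 2 (f.1 ∘ p.1.1.symm) p.2.1 :=
  (contDiffAt_of_contDiffOn_target p (contDiffOn_comp_symm f.2 p.1.2)).of_le
    (WithTop.coe_le_coe.2 le_top)

theorem wirt_diffAt (f : SmoothFun n M) (p : ChartPt n M) (i : Fin n) :
    DifferentiableAt ℝ (fun z => wirt (f.1 ∘ p.1.1.symm) z i) p.2.1 :=
  (contDiffAt_of_contDiffOn_target p
    (contDiffOn_wirt p.1.1.open_target (contDiffOn_comp_symm f.2 p.1.2) i)).differentiableAt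
    (by simp)

theorem formComp_dbarFun_eventuallyEq (f : SmoothFun n M) (p : ChartPt n M) (j : Fin n) :
    formComp p.1.1 (dbarFun f).1 j =ᶠ[𝓝 p.2.1] fun z => wirtBar (f.1 ∘ p.1.1.symm) z j :=
  eventually_of_mem (p.1.1.open_target.mem_nhds p.2.2)
    fun _ hy => formComp_dbarAt f.2 p.1.2 hy j

theorem vecComp_schoutenFun_eventuallyEq (Λ : SmoothBiv n M) (f : SmoothFun n M)
    (p : ChartPt n M) (i : Fin n) :
    vecComp p.1.1 (schoutenFun Λ f).1 i =ᶠ[𝓝 p.2.1]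
      fun z => ∑ k, bivComp p.1.1 Λ.1 i k z * wirt (f.1 ∘ p.1.1.symm) z k :=
  eventually_of_mem (p.1.1.open_target.mem_nhds p.2.2)
    fun _ hy => vecComp_schoutenAt Λ.1 f.2 p.1.2 hy i

theorem dbarForm_dbarFun (f : SmoothFun n M) : dbarForm (dbarFun f) = 0 := by
  funext p j k
  change wirtBar (formComp p.1.1 (dbarFun f).1 k) p.2.1 j
    - wirtBar (formComp p.1.1 (dbarFun f).1 j) p.2.1 k = 0
  rw [wirtBar_congr (formComp_dbarFun_eventuallyEq f p k),
    wirtBar_congr (formComp_dbarFun_eventuallyEq f p j),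
    wirtBar_wirtBar_comm (contDiffAt_comp_symm f p), sub_self]

/-- The component form of `∂̄[Λ, f] + [Λ, ∂̄f] = ι_{∂f} ∂̄Λ`. -/
theorem dbarVec_schoutenFun_add_schoutenForm_dbarFun_apply (Λ : SmoothBiv n M)
    (f : SmoothFun n M) (p : ChartPt n M) (i j : Fin n) :
    (dbarVec (schoutenFun Λ f) + schoutenForm Λ (dbarFun f)) p i j =
      ∑ k, wirt (f.1 ∘ p.1.1.symm) p.2.1 k * wirtBar (bivComp p.1.1 Λ.1 i k) p.2.1 j := by
  change wirtBar (vecComp p.1.1 (schoutenFun Λ f).1 i) p.2.1 j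
    + -∑ k, bivComp p.1.1 Λ.1 i k p.2.1 * wirt (formComp p.1.1 (dbarFun f).1 j) p.2.1 k = _
  rw [wirtBar_congr (vecComp_schoutenFun_eventuallyEq Λ f p i),
    wirtBar_sum_mul _ (fun k _ => biv_diffAt Λ p i k) (fun k _ => wirt_diffAt f p k)]
  simp only [wirt_congr (formComp_dbarFun_eventuallyEq f p j),
    wirtBar_wirt_comm (contDiffAt_comp_symm f p), Finset.sum_add_distrib, add_neg_cancel_comm]

theorem wirt_vecComp_schoutenFun (Λ : SmoothBiv n M) (f : SmoothFun n M) (p : ChartPt n M)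
    (i k : Fin n) :
    wirt (vecComp p.1.1 (schoutenFun Λ f).1 i) p.2.1 k =
      ∑ l, (bivComp p.1.1 Λ.1 i l p.2.1
          * wirt (fun z => wirt (f.1 ∘ p.1.1.symm) z l) p.2.1 k
        + wirt (f.1 ∘ p.1.1.symm) p.2.1 l * wirt (bivComp p.1.1 Λ.1 i l) p.2.1 k) := by
  rw [wirt_congr (vecComp_schoutenFun_eventuallyEq Λ f p i),
    wirt_sum_mul _ (fun l _ => biv_diffAt Λ p i l) (fun l _ => wirt_diffAt f p l)]

theorem schoutenVec_schoutenFun_apply (Λ : SmoothBiv n M) (f : SmoothFun n M)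
    (p : ChartPt n M) (i j : Fin n) :
    schoutenVec Λ (schoutenFun Λ f) p i j =
      ∑ l, wirt (f.1 ∘ p.1.1.symm) p.2.1 l *
        ∑ k, (bivComp p.1.1 Λ.1 i k p.2.1 * wirt (bivComp p.1.1 Λ.1 j l) p.2.1 k
          + bivComp p.1.1 Λ.1 j k p.2.1 * wirt (bivComp p.1.1 Λ.1 l i) p.2.1 k
          + bivComp p.1.1 Λ.1 l k p.2.1 * wirt (bivComp p.1.1 Λ.1 i j) p.2.1 k) := by
  change ∑ k, (bivComp p.1.1 Λ.1 k j p.2.1 * wirt (vecComp p.1.1 (schoutenFun Λ f).1 i) p.2.1 k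
      + bivComp p.1.1 Λ.1 i k p.2.1 * wirt (vecComp p.1.1 (schoutenFun Λ f).1 j) p.2.1 k
      - vecComp p.1.1 (schoutenFun Λ f).1 k p.2.1 * wirt (bivComp p.1.1 Λ.1 i j) p.2.1 k) = _
  simp only [wirt_vecComp_schoutenFun, (vecComp_schoutenFun_eventuallyEq Λ f p _).eq_of_nhds]
  exact sum_bracket_bracket_eq (b := fun k l => bivComp p.1.1 Λ.1 k l p.2.1)
    (s := fun l k => wirt (fun z => wirt (f.1 ∘ p.1.1.symm) z l) p.2.1 k)
    (d := fun k l m => wirt (bivComp p.1.1 Λ.1 k l) p.2.1 m) _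
    (fun k l => congrFun (bivComp_swap p.1.1 Λ.1 k l) p.2.1)
    (fun k l m => by rw [bivComp_swap p.1.1 Λ.1 k l, wirt_neg])
    (fun k l => wirt_wirt_comm (contDiffAt_comp_symm f p) k l) i j

theorem dbarLambdaZero_apply (Λ : SmoothBiv n M) (f : SmoothFun n M) :
    dbarLambdaZero Λ f = (schoutenFun Λ f, dbarFun f) := by
  simp [dbarLambdaZero, dbarZero, schoutenZero]

theorem dbarLambdaOne_dbarLambdaZero {Λ : SmoothBiv n M} (hΛ : IsHolomorphicPoisson Λ)
    (f : SmoothFun n M) : dbarLambdaOne Λ (dbarLambdaZero Λ f) = 0 := by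
  have hvec : schoutenVec Λ (schoutenFun Λ f) = 0 := by
    funext p i j
    have hjacobi (l : Fin n) :=
      (mul_eq_zero_iff_left (two_ne_zero (α := ℂ))).1 (hΛ.schouten_self_eq_zero p i j l)
    simp only [schoutenVec_schoutenFun_apply, hjacobi, mul_zero, Finset.sum_const_zero,
      Pi.zero_apply]
  have hmixed : dbarVec (schoutenFun Λ f) + schoutenForm Λ (dbarFun f) = 0 := by
    funext p i j
    simp only [dbarVec_schoutenFun_add_schoutenForm_dbarFun_apply, hΛ.dbar_eq_zero, mul_zero,
      Finset.sum_const_zero, Pi.zero_apply]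
  rw [dbarLambdaZero_apply, dbarLambdaOne_apply, hvec, hmixed, dbarForm_dbarFun,
    Prod.mk_zero_zero, Prod.mk_zero_zero]

end Square

/-! ### Holomorphic functions -/

section Holomorphic

variable {n : ℕ} {M : Type*} [TopologicalSpace M] [ChartedSpace (Cn n) M]

theorem exists_restrictScalars_eq_iff_conjPart_eq_zero {T : Cn n →L[ℝ] ℂ} :
    (∃ A : Cn n →L[ℂ] ℂ, A.restrictScalars ℝ = T) ↔ conjPart T = 0 := by
  constructor
  · rintro ⟨A, rfl⟩
    refine LinearMap.ext fun v => ?_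
    change (A v + Complex.I * A (Complex.I • v)) / 2 = 0
    rw [map_smul, smul_eq_mul]
    linear_combination (A v / 2) * Complex.I_sq
  · intro hT
    have hlin (v : Cn n) : T v = linPart T v := by
      have hv : (T v + Complex.I * T (Complex.I • v)) / 2 = 0 := DFunLike.congr_fun hT v
      change T v = (T v - Complex.I * T (Complex.I • v)) / 2
      linear_combination hv
    exact ⟨⟨linPart T, T.continuous.congr hlin⟩, ContinuousLinearMap.ext fun v => (hlin v).symm⟩

theorem mdifferentiableAt_complex_iff_dbarAt_eq_zero {f : M → ℂ} {x : M}
    (hf : MDifferentiableAt 𝓘(ℝ, Cn n) 𝓘(ℝ, ℂ) f x) :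
    MDifferentiableAt 𝓘(ℂ, Cn n) 𝓘(ℂ, ℂ) f x ↔ dbarAt n f x = 0 := by
  have hderiv : realDeriv f x =
      fderivWithin ℝ (writtenInExtChartAt 𝓘(ℝ, Cn n) 𝓘(ℝ, ℂ) x f)
        (Set.range 𝓘(ℝ, Cn n)) (extChartAt 𝓘(ℝ, Cn n) x x) := hf.mfderiv
  rw [mdifferentiableAt_iff] at hf ⊢
  refine Iff.trans ?_ exists_restrictScalars_eq_iff_conjPart_eq_zero
  rw [hderiv, and_iff_right hf.1]
  exact differentiableWithinAt_iff_restrictScalars ℝ hf.2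
    (𝓘(ℝ, Cn n).uniqueDiffOn _ (Set.mem_range_self _))

theorem schoutenFun_eq_zero_of_isLocallyConstant [IsManifold 𝓘(ℂ, Cn n) ω M] (Λ : SmoothBiv n M)
    {f : SmoothFun n M} (hf : IsLocallyConstant f.1) : schoutenFun Λ f = 0 := by
  refine Subtype.ext (funext fun x => PiLp.ext fun i => (Λ.1 x).map_coord_zero 1 ?_)
  have hderiv : realDeriv (n := n) f.1 x = 0 :=
    (EventuallyEq.mfderiv_eq (f := fun _ => f.1 x) (hf.eventually_eq x)).trans mfderiv_const
  change linPart (realDeriv (n := n) f.1 x) = 0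
  rw [hderiv, ← zero_smul ℂ (0 : Cn n →L[ℝ] ℂ), linPart_smul, zero_smul]

theorem isLocallyConstant_of_dbarFun_eq_zero [CompactSpace M] [IsManifold 𝓘(ℂ, Cn n) ω M]
    {f : SmoothFun n M} (hf : dbarFun f = 0) : IsLocallyConstant f.1 := by
  have : IsManifold 𝓘(ℂ, Cn n) 1 M := IsManifold.of_le (n := ω) le_top
  have hhol : MDifferentiable 𝓘(ℂ, Cn n) 𝓘(ℂ, ℂ) f.1 := fun x =>
    (mdifferentiableAt_complex_iff_dbarAt_eq_zero
      (ContMDiff.mdifferentiableAt f.2 (by simp))).2 (congrFun (congrArg Subtype.val hf) x)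
  exact hhol.isLocallyConstant

end Holomorphic

/-! ### Cohomology classes of Poisson vector fields -/

section CohomologyClass

variable {A B C : Type*} [AddCommGroup A] [Module ℂ A] [AddCommGroup B] [Module ℂ B]
  [AddCommGroup C] [Module ℂ C] {d₀ : A →ₗ[ℂ] B} {d₁ : B →ₗ[ℂ] C}

theorem cohomologyClass_eq_zero_iff {b : B} {hb : d₁ b = 0} :
    cohomologyClass d₀ d₁ b hb = 0 ↔ ∃ a, d₀ a = b :=
  Submodule.Quotient.mk_eq_zero _

theorem cohomologyClass_eq_iff {b b' : B} {hb : d₁ b = 0} {hb' : d₁ b' = 0} :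
    cohomologyClass d₀ d₁ b hb = cohomologyClass d₀ d₁ b' hb' ↔ ∃ a, d₀ a = b - b' :=
  Submodule.Quotient.eq _

theorem exists_cohomologyClass_eq (c : Cohomology d₀ d₁) :
    ∃ b hb, cohomologyClass d₀ d₁ b hb = c := by
  obtain ⟨⟨b, hb⟩, rfl⟩ := Submodule.Quotient.mk_surjective _ c
  exact ⟨b, hb, rfl⟩

end CohomologyClass

section Comparison

variable {n : ℕ} {M : Type*} [TopologicalSpace M] [ChartedSpace (Cn n) M]

theorem mem_poissonFields_iff (Λ : SmoothBiv n M) (W : SmoothVec n M) :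
    W ∈ poissonFields Λ ↔ dbarLambdaOne Λ (W, 0) = 0 := by
  rw [dbarLambdaOne_apply, map_zero, map_zero, add_zero, Prod.mk_eq_zero, Prod.mk_eq_zero,
    and_iff_left rfl, and_comm]
  rfl

variable [IsManifold 𝓘(ℂ, Cn n) ω M]

theorem exists_dbarLambdaZero_eq_poissonField_sub {Λ : SmoothBiv n M} (hΛ : IsHolomorphicPoisson Λ)
    (hO : Subsingleton (DolbeaultH1 n M)) {σ : SmoothL n M} (hσ : dbarLambdaOne Λ σ = 0) :
    ∃ (W : poissonFields Λ) (f : SmoothFun n M),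
      dbarLambdaZero Λ f = ((W : SmoothVec n M), 0) - σ := by
  obtain ⟨Z, η⟩ := σ
  have hη : dbarForm η = 0 := by
    rw [dbarLambdaOne_apply] at hσ
    exact congrArg (fun w => w.2.2) hσ
  obtain ⟨f, rfl⟩ : ∃ f, dbarFun f = η :=
    cohomologyClass_eq_zero_iff.1 (hO.elim (cohomologyClass dbarFun dbarForm η hη) 0)
  have hsub : (Z - schoutenFun Λ f, 0) = (Z, dbarFun f) - dbarLambdaZero Λ f := by
    rw [dbarLambdaZero_apply, Prod.mk_sub_mk, sub_self]
  have hW : Z - schoutenFun Λ f ∈ poissonFields Λ := by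
    rw [mem_poissonFields_iff, hsub, map_sub, hσ, dbarLambdaOne_dbarLambdaZero hΛ, sub_zero]
  exact ⟨⟨_, hW⟩, -f, by rw [hsub, map_neg, sub_sub_cancel_left]⟩

/-- The comparison map of the theorem, sending a holomorphic vector field `W` with `[Λ, W] = 0`
to the class of `(W, 0)`. -/
def poissonFieldsToH1 (Λ : SmoothBiv n M) : poissonFields Λ →ₗ[ℂ] H1Lambda Λ :=
  Submodule.mkQ _ ∘ₗ LinearMap.codRestrict (LinearMap.ker (dbarLambdaOne Λ))
    (LinearMap.inl ℂ _ _ ∘ₗ (poissonFields Λ).subtype)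
    fun W => (mem_poissonFields_iff Λ W.1).1 W.2

theorem poissonFieldsToH1_apply (Λ : SmoothBiv n M) (W : poissonFields Λ) :
    poissonFieldsToH1 Λ W = cohomologyClass (dbarLambdaZero Λ) (dbarLambdaOne Λ)
      ((W : SmoothVec n M), 0) ((mem_poissonFields_iff Λ W).1 W.2) :=
  rfl

theorem poissonFieldsToH1_injective {Λ : SmoothBiv n M}
    (hΛ : ∀ f : SmoothFun n M, dbarFun f = 0 → schoutenFun Λ f = 0) :
    Function.Injective (poissonFieldsToH1 Λ) := by
  refine (injective_iff_map_eq_zero _).2 fun W hW => ?_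
  rw [poissonFieldsToH1_apply] at hW
  obtain ⟨f, hf⟩ := cohomologyClass_eq_zero_iff.1 hW
  rw [dbarLambdaZero_apply] at hf
  obtain ⟨hvec, hform⟩ := Prod.mk.inj hf
  exact Subtype.ext (hvec.symm.trans (hΛ f hform))

theorem poissonFieldsToH1_surjective {Λ : SmoothBiv n M} (hΛ : IsHolomorphicPoisson Λ)
    (hO : Subsingleton (DolbeaultH1 n M)) : Function.Surjective (poissonFieldsToH1 Λ) := by
  intro c
  obtain ⟨σ, hσ, rfl⟩ := exists_cohomologyClass_eq c
  obtain ⟨W, hW⟩ := exists_dbarLambdaZero_eq_poissonField_sub hΛ hO hσ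
  exact ⟨W, (poissonFieldsToH1_apply Λ W).trans (cohomologyClass_eq_iff.2 hW)⟩

end Comparison

end HolPoisson

end

theorem proposition4p5_general (n : ℕ) (M : Type*) [TopologicalSpace M]
    [ChartedSpace (HolPoisson.Cn n) M] [IsManifold 𝓘(ℂ, HolPoisson.Cn n) ω M]
    (Λ : HolPoisson.SmoothBiv n M) (hΛ : HolPoisson.IsHolomorphicPoisson Λ)
    (hO : Subsingleton (HolPoisson.DolbeaultH1 n M))
    (hC : ∀ f : HolPoisson.SmoothFun n M,
      HolPoisson.dbarFun f = 0 → HolPoisson.schoutenFun Λ f = 0) :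
    ∃ e : HolPoisson.poissonFields Λ ≃ₗ[ℂ] HolPoisson.H1Lambda Λ,
      ∀ W : HolPoisson.poissonFields Λ,
        ∃ hW : HolPoisson.dbarLambdaOne Λ ((W : HolPoisson.SmoothVec n M), 0) = 0,
          e W = HolPoisson.cohomologyClass (HolPoisson.dbarLambdaZero Λ)
            (HolPoisson.dbarLambdaOne Λ) ((W : HolPoisson.SmoothVec n M), 0) hW :=
  ⟨LinearEquiv.ofBijective (HolPoisson.poissonFieldsToH1 Λ)
      ⟨HolPoisson.poissonFieldsToH1_injective hC, HolPoisson.poissonFieldsToH1_surjective hΛ hO⟩,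
    fun W => ⟨(HolPoisson.mem_poissonFields_iff Λ W).1 W.2,
      HolPoisson.poissonFieldsToH1_apply Λ W⟩⟩

theorem proposition4p5 (n : ℕ) (M : Type*) [TopologicalSpace M] [T2Space M] [CompactSpace M]
    [ChartedSpace (HolPoisson.Cn n) M] [IsManifold 𝓘(ℂ, HolPoisson.Cn n) ω M]
    (Λ : HolPoisson.SmoothBiv n M) (hΛ : HolPoisson.IsHolomorphicPoisson Λ)
    (hO : Subsingleton (HolPoisson.DolbeaultH1 n M)) :
    ∃ e : HolPoisson.poissonFields Λ ≃ₗ[ℂ] HolPoisson.H1Lambda Λ,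
      ∀ W : HolPoisson.poissonFields Λ,
        ∃ hW : HolPoisson.dbarLambdaOne Λ ((W : HolPoisson.SmoothVec n M), 0) = 0,
          e W = HolPoisson.cohomologyClass (HolPoisson.dbarLambdaZero Λ)
            (HolPoisson.dbarLambdaOne Λ) ((W : HolPoisson.SmoothVec n M), 0) hW := by
  exact proposition4p5_general n M Λ hΛ hO fun _ hf =>
    HolPoisson.schoutenFun_eq_zero_of_isLocallyConstant Λ
      (HolPoisson.isLocallyConstant_of_dbarFun_eq_zero hf)
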